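/- Let $\mathcal H$ and $\mathcal H_{aux}$ be complex Hilbert spaces with fixed orthonormal bases $\{|n\rangle : n=0,1,2,\dots\}$, and let $a,a^*$ on $\mathcal H$ and $b,b^*$ on $\mathcal H_{aux}$ be the corresponding annihilation and creation operators, with natural domains $D(a)=D(a^*)=\{\varphi\in\mathcal H : \sum_n n|\langle n|\varphi\rangle|^2<\infty\}$ and $D(b)=D(b^*)$ defined likewise. For $z\in\mathbb C$ let $|z\rangle = e^{-|z|^2/2}\sum_{n\ge 0}\frac{z^n}{\sqrt{n!}}|n\rangle$ be the coherent state (in either space), and let $D_{coh}$ be the linear span of $\{|\beta\rangle:\beta\in\mathbb C\}$ in $\mathcal H$. Let $A$ be the closure of the operator $\frac1{\sqrt2}(a\otimes b^*+a^*\otimes b)$, defined on the algebraic tensor product $D(a)\otimes D(b)$, in the Hilbert space tensor product $\mathcal H\otimes\mathcal H_{aux}$. A semispectral measure on $\mathcal H$ is a weakly $\sigma$-additive map $E$ from the Borel sets of $\mathbb R$ to the positive bounded operators on $\mathcal H$ with $E(\mathbb R)=I$; for $\varphi\in\mathcal H$ put $E_\varphi(B)=\langle\varphi|E(B)\varphi\rangle$.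 For $z\in\mathbb C\setminus\{0\}$, the homodyne observable $E^z$ is the semispectral measure on $\mathcal H$ given by $$E^z(B)=V_z^*\,E^{|z|^{-1}A}(B)\,V_z\quad (B\subset\mathbb R \text{ Borel}),\qquad V_z\varphi=\varphi\otimes|z\rangle,$$ where $E^{|z|^{-1}A}$ is the spectral measure of $|z|^{-1}A$. Proposition. For every $z\in\mathbb C\setminus\{0\}$, the observable $E^z$ is well defined (it exists and is unique), and it is $D_{coh}$-determinate: for every $\varphi\in D_{coh}$ all moments $\int x^k\,dE^z_\varphi(x)$, $k=0,1,2,\dots$, are finite, and $E^z_\varphi$ is the only finite positive Borel measure on $\mathbb R$ with these moments. -/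

import Mathlib

open scoped InnerProductSpace TensorProduct

noncomputable section

namespace Homodyne

/-! ## Semispectral measures on the real line -/

section Semispectral

variable {H : Type*} [NormedAddCommGroup H] [InnerProductSpace ℂ H] [CompleteSpace H]

variable (H) in
/-- A semispectral measure (normalized positive operator measure) on the Borel sets of `ℝ`:
a weakly σ-additive map into the positive bounded operators with `E ℝ = 1`.
As for `MeasureTheory.VectorMeasure`, the irrelevant value on non-Borel sets is set to `0`,
so that two semispectral measures are equal iff they agree on all Borel sets. -/
structure SemispectralMeasure where
  /-- The operator assigned to a set. -/
  toFun : Set ℝ → H →L[ℂ] H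
  pos' : ∀ B, MeasurableSet B → (toFun B).IsPositive
  univ' : toFun Set.univ = 1
  not_measurable' : ∀ B, ¬ MeasurableSet B → toFun B = 0
  iUnion' : ∀ f : ℕ → Set ℝ, (∀ i, MeasurableSet (f i)) →
    Pairwise (Function.onFun Disjoint f) →
      ∀ φ ψ : H, HasSum (fun i => ⟪ψ, toFun (f i) φ⟫_ℂ) ⟪ψ, toFun (⋃ i, f i) φ⟫_ℂ

instance : CoeFun (SemispectralMeasure H) (fun _ => Set ℝ → H →L[ℂ] H) :=
  ⟨SemispectralMeasure.toFun⟩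

namespace SemispectralMeasure

theorem inner_empty (E : SemispectralMeasure H) (φ ψ : H) : ⟪ψ, E ∅ φ⟫_ℂ = 0 := by
  have h := E.iUnion' (fun _ => ∅) (fun _ => MeasurableSet.empty)
    (fun _ _ _ => Set.disjoint_empty _) φ ψ
  exact tendsto_nhds_unique tendsto_const_nhds h.summable.tendsto_atTop_zero

/-- The positive measure `E_φ : B ↦ ⟪φ, E(B) φ⟫`. -/
def measure (E : SemispectralMeasure H) (φ : H) : MeasureTheory.Measure ℝ :=
  MeasureTheory.Measure.ofMeasurable
    (fun B _ => ENNReal.ofReal (⟪φ, E B φ⟫_ℂ).re)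
    (by simp [E.inner_empty])
    (by
      intro f hf hd
      have h := Complex.reCLM.hasSum (E.iUnion' f hf hd φ φ)
      simp only [Complex.reCLM_apply] at h
      rw [← h.tsum_eq]
      exact ENNReal.ofReal_tsum_of_nonneg
        (fun i => (E.pos' (f i) (hf i)).re_inner_nonneg_right φ) h.summable)

theorem measure_apply (E : SemispectralMeasure H) (φ : H) {B : Set ℝ} (hB : MeasurableSet B) :
    E.measure φ B = ENNReal.ofReal (⟪φ, E B φ⟫_ℂ).re :=
  MeasureTheory.Measure.ofMeasurable_apply B hB

/-- `F` is the spectral measure of the (in general unbounded) operator `S`: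
`F` is projection valued, `S` has domain `{φ | ∫ x² dF_φ < ∞}`, and
`⟪φ, S φ⟫ = ∫ x dF_φ` there. -/
def IsSpectralMeasureOf (F : SemispectralMeasure H) (S : H →ₗ.[ℂ] H) : Prop :=
  (∀ B, MeasurableSet B → IsStarProjection (F B)) ∧
  (∀ φ : H, φ ∈ S.domain ↔ MeasureTheory.Integrable (fun x : ℝ => x ^ 2) (F.measure φ)) ∧
  (∀ φ : S.domain, ⟪(φ : H), S φ⟫_ℂ = ((∫ x, x ∂(F.measure (φ : H)) : ℝ) : ℂ))

end SemispectralMeasure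

/-- A measure on `ℝ` is determinate if all its moments are finite and it is the only finite
positive Borel measure with these moments. -/
def IsDeterminate (μ : MeasureTheory.Measure ℝ) : Prop :=
  (∀ k : ℕ, MeasureTheory.Integrable (fun x : ℝ => x ^ k) μ) ∧
  ∀ ν : MeasureTheory.Measure ℝ, MeasureTheory.IsFiniteMeasure ν →
    (∀ k : ℕ, MeasureTheory.Integrable (fun x : ℝ => x ^ k) ν ∧
      ∫ x, x ^ k ∂ν = ∫ x, x ^ k ∂μ) → ν = μ

/-- `E` is `D`-determinate if `E_φ` is determinate for every `φ ∈ D`. -/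
def SemispectralMeasure.IsDeterminateOn (E : SemispectralMeasure H) (D : Set H) : Prop :=
  ∀ φ ∈ D, IsDeterminate (E.measure φ)

end Semispectral

/-! ## One mode: coherent states, annihilation and creation operators -/

section OneMode

variable {H : Type*} [NormedAddCommGroup H] [InnerProductSpace ℂ H]

/-- The vector `∑ n, c n |n⟩` for a square-summable sequence `c`. -/
def ofCoeff (e : HilbertBasis ℕ ℂ H) (c : ℕ → ℂ) (hc : Summable fun n => ‖c n‖ ^ 2) : H :=
  e.repr.symm ⟨c, (memℓp_gen_iff (by norm_num)).2 (by simpa using hc)⟩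

theorem inner_ofCoeff (e : HilbertBasis ℕ ℂ H) (c : ℕ → ℂ) (hc : Summable fun n => ‖c n‖ ^ 2)
    (n : ℕ) : ⟪e n, ofCoeff e c hc⟫_ℂ = c n := by
  rw [← e.repr_apply_apply, ofCoeff, LinearIsometryEquiv.apply_symm_apply]

theorem ext_inner_basis (e : HilbertBasis ℕ ℂ H) {x y : H}
    (h : ∀ n, ⟪e n, x⟫_ℂ = ⟪e n, y⟫_ℂ) : x = y := by
  apply e.repr.injective
  ext n
  simpa [e.repr_apply_apply] using h n

theorem summable_coherent (z : ℂ) :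
    Summable fun n : ℕ =>
      ‖(Real.exp (-(‖z‖ ^ 2) / 2) : ℂ) * (z ^ n / (Real.sqrt (n.factorial : ℝ) : ℂ))‖ ^ 2 := by
  have h := (Real.summable_pow_div_factorial (‖z‖ ^ 2)).mul_left (Real.exp (-(‖z‖ ^ 2) / 2) ^ 2)
  refine h.congr fun n => ?_
  rw [norm_mul, norm_div, norm_pow, Complex.norm_real, Complex.norm_real, mul_pow, div_pow,
    Real.norm_eq_abs, Real.norm_eq_abs, sq_abs, sq_abs, Real.sq_sqrt (by positivity),
    ← pow_mul, ← pow_mul, mul_comm n 2]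

/-- The coherent state `|z⟩ = exp(-|z|²/2) ∑ n, zⁿ/√(n!) |n⟩`. -/
def coherent (e : HilbertBasis ℕ ℂ H) (z : ℂ) : H :=
  ofCoeff e _ (summable_coherent z)

/-- `D_coh`, the algebraic linear span of the coherent states. -/
def coherentSpan (e : HilbertBasis ℕ ℂ H) : Submodule ℂ H :=
  Submodule.span ℂ (Set.range (coherent e))

/-- The common domain `{φ | ∑ n |⟨n|φ⟩|² < ∞}` of the annihilation and creation operators. -/
def ladderDomain (e : HilbertBasis ℕ ℂ H) : Submodule ℂ H where
  carrier := {φ | Summable fun n : ℕ => (n : ℝ) * ‖⟪e n, φ⟫_ℂ‖ ^ 2}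
  zero_mem' := by simp
  add_mem' := by
    intro x y hx hy
    have hx' : Summable fun n : ℕ => (n : ℝ) * ‖⟪e n, x⟫_ℂ‖ ^ 2 := hx
    have hy' : Summable fun n : ℕ => (n : ℝ) * ‖⟪e n, y⟫_ℂ‖ ^ 2 := hy
    refine Summable.of_nonneg_of_le (fun n => by positivity) (fun n => ?_)
      ((hx'.mul_left 2).add (hy'.mul_left 2))
    have h1 : ‖⟪e n, x + y⟫_ℂ‖ ≤ ‖⟪e n, x⟫_ℂ‖ + ‖⟪e n, y⟫_ℂ‖ := by
      rw [inner_add_right]; exact norm_add_le _ _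
    have h2 : ‖⟪e n, x + y⟫_ℂ‖ ^ 2 ≤ 2 * ‖⟪e n, x⟫_ℂ‖ ^ 2 + 2 * ‖⟪e n, y⟫_ℂ‖ ^ 2 := by
      nlinarith [norm_nonneg ⟪e n, x + y⟫_ℂ, sq_nonneg (‖⟪e n, x⟫_ℂ‖ - ‖⟪e n, y⟫_ℂ‖)]
    have hn : (0 : ℝ) ≤ n := Nat.cast_nonneg n
    nlinarith [mul_le_mul_of_nonneg_left h2 hn]
  smul_mem' := by
    intro c x hx
    have hx' : Summable fun n : ℕ => (n : ℝ) * ‖⟪e n, x⟫_ℂ‖ ^ 2 := hx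
    refine (hx'.mul_left (‖c‖ ^ 2)).congr fun n => ?_
    rw [inner_smul_right, norm_mul]; ring

theorem summable_annihilation (e : HilbertBasis ℕ ℂ H) (φ : ladderDomain e) :
    Summable fun n : ℕ => ‖(Real.sqrt (n + 1) : ℂ) * ⟪e (n + 1), (φ : H)⟫_ℂ‖ ^ 2 := by
  have h : Summable fun n : ℕ => (n : ℝ) * ‖⟪e n, (φ : H)⟫_ℂ‖ ^ 2 := φ.2
  refine ((summable_nat_add_iff 1).2 h).congr fun n => ?_
  rw [norm_mul, mul_pow, Complex.norm_real, Real.norm_eq_abs, sq_abs,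
    Real.sq_sqrt (by positivity)]
  push_cast
  rfl

theorem summable_creation (e : HilbertBasis ℕ ℂ H) (φ : ladderDomain e) :
    Summable fun n : ℕ => ‖(Real.sqrt n : ℂ) * ⟪e (n - 1), (φ : H)⟫_ℂ‖ ^ 2 := by
  have h : Summable fun n : ℕ => (n : ℝ) * ‖⟪e n, (φ : H)⟫_ℂ‖ ^ 2 := φ.2
  have h0 : Summable fun n : ℕ => ‖⟪e n, (φ : H)⟫_ℂ‖ ^ 2 := by
    have := (e.orthonormal).inner_products_summable (φ : H)
    simpa using this
  refine (summable_nat_add_iff 1).1 ((h.add h0).congr fun n => ?_)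
  rw [norm_mul, mul_pow, Complex.norm_real, Real.norm_eq_abs, sq_abs,
    Real.sq_sqrt (by positivity)]
  rw [Nat.add_sub_cancel]
  push_cast
  ring

/-- The annihilation operator `a : ∑ cₙ|n⟩ ↦ ∑ √(n+1) cₙ₊₁|n⟩` as a linear map
on its natural domain. -/
def annihilation (e : HilbertBasis ℕ ℂ H) : ladderDomain e →ₗ[ℂ] H where
  toFun := fun φ => ofCoeff e _ (summable_annihilation e φ)
  map_add' := by
    intro x y
    apply ext_inner_basis e
    intro n
    simp only [inner_add_right, inner_ofCoeff, Submodule.coe_add]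
    ring
  map_smul' := by
    intro c x
    apply ext_inner_basis e
    intro n
    simp only [inner_smul_right, inner_ofCoeff, Submodule.coe_smul, RingHom.id_apply]
    ring

/-- The creation operator `a* : ∑ cₙ|n⟩ ↦ ∑ √n cₙ₋₁|n⟩` as a linear map on its natural domain
(the term `n = 0` vanishes because of the factor `√0`). -/
def creation (e : HilbertBasis ℕ ℂ H) : ladderDomain e →ₗ[ℂ] H where
  toFun := fun φ => ofCoeff e _ (summable_creation e φ)
  map_add' := by
    intro x y
    apply ext_inner_basis e
    intro n
    simp only [inner_add_right, inner_ofCoeff, Submodule.coe_add]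
    ring
  map_smul' := by
    intro c x
    apply ext_inner_basis e
    intro n
    simp only [inner_smul_right, inner_ofCoeff, Submodule.coe_smul, RingHom.id_apply]
    ring

end OneMode

/-! ## Two modes: the homodyne detector -/

section TwoModes

variable {H K : Type*} [NormedAddCommGroup H] [InnerProductSpace ℂ H]
  [NormedAddCommGroup K] [InnerProductSpace ℂ K]

variable (H K) in
/-- The Hilbert space tensor product of `H` and `K`. -/
abbrev TwoMode : Type _ := UniformSpace.Completion (H ⊗[ℂ] K)

/-- The inclusion of the algebraic tensor product `D(a) ⊗ D(b)` into the Hilbert space tensor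
product. -/
def ladderInclusion (e : HilbertBasis ℕ ℂ H) (f : HilbertBasis ℕ ℂ K) :
    (ladderDomain e ⊗[ℂ] ladderDomain f) →ₗ[ℂ] TwoMode H K :=
  (UniformSpace.Completion.toComplₗᵢ (𝕜 := ℂ) (E := H ⊗[ℂ] K)).toLinearMap ∘ₗ
    TensorProduct.map (ladderDomain e).subtype (ladderDomain f).subtype

theorem ladderInclusion_injective (e : HilbertBasis ℕ ℂ H) (f : HilbertBasis ℕ ℂ K) :
    Function.Injective (ladderInclusion e f) :=
  (UniformSpace.Completion.toComplₗᵢ (𝕜 := ℂ) (E := H ⊗[ℂ] K)).injective.comp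
    (TensorProduct.map_injective_of_flat_flat _ _
      (ladderDomain e).subtype_injective (ladderDomain f).subtype_injective)

/-- The operator `(1/√2) (a ⊗ b* + a* ⊗ b)` on the algebraic tensor product `D(a) ⊗ D(b)`. -/
def couplingCore (e : HilbertBasis ℕ ℂ H) (f : HilbertBasis ℕ ℂ K) :
    TwoMode H K →ₗ.[ℂ] TwoMode H K where
  domain := LinearMap.range (ladderInclusion e f)
  toFun :=
    ((1 / Real.sqrt 2 : ℝ) : ℂ) •
      ((UniformSpace.Completion.toComplₗᵢ (𝕜 := ℂ) (E := H ⊗[ℂ] K)).toLinearMap ∘ₗ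
        (TensorProduct.map (annihilation e) (creation f) +
          TensorProduct.map (creation e) (annihilation f)) ∘ₗ
        (LinearEquiv.ofInjective (ladderInclusion e f)
          (ladderInclusion_injective e f)).symm.toLinearMap)

/-- The operator `A`, the closure of `(1/√2) (a ⊗ b* + a* ⊗ b)`. -/
def coupling (e : HilbertBasis ℕ ℂ H) (f : HilbertBasis ℕ ℂ K) :
    TwoMode H K →ₗ.[ℂ] TwoMode H K :=
  (couplingCore e f).closure

/-- The map `V_z : φ ↦ φ ⊗ |z⟩`. -/
def appendCoherent (H : Type*) [NormedAddCommGroup H] [InnerProductSpace ℂ H]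
    (f : HilbertBasis ℕ ℂ K) (z : ℂ) : H →L[ℂ] TwoMode H K :=
  (UniformSpace.Completion.toComplL (𝕜 := ℂ) (E := H ⊗[ℂ] K)) ∘L
    (TensorProduct.mkL ℂ H K).flip (coherent f z)

/-- `E` is the observable `E^z` measured by the balanced homodyne detector with auxiliary
coherent state `|z⟩`: `E(B) = V_z* F(B) V_z` for all Borel sets `B`, where `F` is the spectral
measure of `|z|⁻¹ A`. -/
def IsHomodyneObservable [CompleteSpace H] (e : HilbertBasis ℕ ℂ H) (f : HilbertBasis ℕ ℂ K)
    (z : ℂ) (E : SemispectralMeasure H) : Prop :=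
  ∃ F : SemispectralMeasure (TwoMode H K),
    F.IsSpectralMeasureOf (((‖z‖⁻¹ : ℝ) : ℂ) • coupling e f) ∧
    ∀ B, MeasurableSet B →
      E B = ContinuousLinearMap.adjoint (appendCoherent H f z) ∘L F B ∘L appendCoherent H f z

end TwoModes

end Homodyne

end

noncomputable section

namespace Homodyne

/-! ## Determinacy from exponential moments -/

section Determinacy

open MeasureTheory

/-! The coupling moves one quantum between the modes and preserves the total number `n`. Each layer
`k + m = n` is finite-dimensional and invariant, so the symmetric operator is diagonalized there,
and the layers together give a Hilbert basis of eigenvectors (`exists_graded_eigenbasis`). Its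
closure is then the maximal diagonal operator in this basis (`isDiagonal_closure`), which yields an
explicit spectral measure. Any other spectral measure acts on each eigenvector by the indicator of
its eigenvalue, hence coincides with it on a dense subspace.

For determinacy, `E^z_φ` is the spectral distribution in the state `φ ⊗ |z⟩`. Eigenvalues in layer
`n` are at most `2(n + 1)` in modulus (`abs_eigenvalue_le`), while a product of coherent states has
Poisson-type weight in layer `n`, smaller than any geometric sequence. All integrals of `exp |t x|`
are therefore finite, and this property survives linear combinations. Such a measure is determinate:
the integrals of `cosh (t x)` depend only on even moments, so a competitor has the same exponential
moments, and both characteristic functions are the same power series in the moments. -/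

theorem lintegral_cosh_eq_tsum {ν : Measure ℝ}
    (h : ∀ k : ℕ, Integrable (fun x : ℝ => x ^ k) ν) (t : ℝ) :
    ∫⁻ x, ENNReal.ofReal (Real.cosh (t * x)) ∂ν =
      ∑' k : ℕ, ENNReal.ofReal (t ^ (2 * k) / (2 * k).factorial * ∫ x, x ^ (2 * k) ∂ν) := by
  have h0 (k : ℕ) (x : ℝ) : 0 ≤ (t * x) ^ (2 * k) / (2 * k).factorial :=
    div_nonneg ((even_two_mul k).pow_nonneg _) (Nat.cast_nonneg _)
  have h1 (x : ℝ) : ENNReal.ofReal (Real.cosh (t * x)) =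
      ∑' k : ℕ, ENNReal.ofReal ((t * x) ^ (2 * k) / (2 * k).factorial) := by
    rw [← (Real.hasSum_cosh (t * x)).tsum_eq]
    exact ENNReal.ofReal_tsum_of_nonneg (h0 · x) (Real.hasSum_cosh (t * x)).summable
  simp_rw [h1]
  -- Even powers make every term nonnegative, so Tonelli applies without exponential integrability;
  -- the formula thus holds for a competitor known only through its moments.
  rw [lintegral_tsum fun k => by fun_prop]
  refine tsum_congr fun k => ?_
  have h2 : (fun x : ℝ => (t * x) ^ (2 * k) / (2 * k).factorial) =
      fun x => t ^ (2 * k) / (2 * k).factorial * x ^ (2 * k) := by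
    funext x; rw [mul_pow]; ring
  rw [← ofReal_integral_eq_lintegral_ofReal (by rw [h2]; exact (h _).const_mul _)
    (Filter.Eventually.of_forall (h0 k)), h2, integral_const_mul]

theorem integrable_exp_abs_iff {ν : Measure ℝ} (t : ℝ) :
    Integrable (fun x : ℝ => Real.exp |t * x|) ν ↔
      ∫⁻ x, ENNReal.ofReal (Real.cosh (t * x)) ∂ν < ⊤ := by
  have hc : Integrable (fun x : ℝ => Real.cosh (t * x)) ν ↔
      ∫⁻ x, ENNReal.ofReal (Real.cosh (t * x)) ∂ν < ⊤ := by
    rw [← hasFiniteIntegral_iff_ofReal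
      (Filter.Eventually.of_forall fun x => (Real.cosh_pos (t * x)).le), Integrable]
    exact and_iff_right (by fun_prop)
  rw [← hc]
  constructor
  · intro h
    refine h.mono' (by fun_prop) (Filter.Eventually.of_forall fun x => ?_)
    rw [Real.norm_eq_abs, abs_of_pos (Real.cosh_pos _), ← Real.cosh_abs, Real.cosh_eq]
    have : Real.exp (-|t * x|) ≤ Real.exp |t * x| :=
      Real.exp_le_exp.2 (by linarith [abs_nonneg (t * x)])
    linarith
  · intro h
    refine (h.const_mul 2).mono' (by fun_prop) (Filter.Eventually.of_forall fun x => ?_)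
    rw [Real.norm_eq_abs, Real.abs_exp, ← Real.cosh_abs, Real.cosh_eq]
    linarith [Real.exp_pos (-|t * x|)]

/-- The exponential series is integrated termwise, its partial sums being dominated by `exp |t x|`.
-/
theorem charFun_eq_tsum {ν : Measure ℝ}
    (h : ∀ t, Integrable (fun x : ℝ => Real.exp |t * x|) ν) (t : ℝ) :
    charFun ν t =
      ∑' k : ℕ, ((t : ℂ) * Complex.I) ^ k / k.factorial * ((∫ x, x ^ k ∂ν : ℝ) : ℂ) := by
  have hs (y : ℂ) := NormedSpace.expSeries_div_hasSum_exp y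
  simp_rw [← Complex.exp_eq_exp_ℂ] at hs
  have key : HasSum (fun k : ℕ => ∫ x : ℝ, ((t * x : ℝ) * Complex.I) ^ k / k.factorial ∂ν)
      (∫ x : ℝ, Complex.exp ((t * x : ℝ) * Complex.I) ∂ν) := by
    have hr (x : ℝ) : HasSum (fun k : ℕ => |t * x| ^ k / k.factorial) (Real.exp |t * x|) := by
      rw [Real.exp_eq_exp_ℝ]; exact NormedSpace.expSeries_div_hasSum_exp _
    refine hasSum_integral_of_dominated_convergence
      (fun k x => |t * x| ^ k / k.factorial) (fun k => by fun_prop) (fun k => ?_) ?_ ?_ ?_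
    · refine Filter.Eventually.of_forall fun x => le_of_eq ?_
      simp
    · exact Filter.Eventually.of_forall fun x => (hr x).summable
    · refine (h t).congr (Filter.Eventually.of_forall fun x => ((hr x).tsum_eq).symm)
    · exact Filter.Eventually.of_forall fun x => hs _
  rw [charFun_apply_real]
  have e1 : (∫ x : ℝ, Complex.exp (t * x * Complex.I) ∂ν) =
      ∫ x : ℝ, Complex.exp ((t * x : ℝ) * Complex.I) ∂ν := by
    simp
  rw [e1, ← key.tsum_eq]
  refine tsum_congr fun k => ?_
  rw [← integral_complex_ofReal, ← integral_const_mul]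
  congr 1; funext x
  push_cast
  ring

theorem integrable_pow_of_integrable_exp_abs {ν : Measure ℝ}
    (h : Integrable (fun x : ℝ => Real.exp |1 * x|) ν) (k : ℕ) :
    Integrable (fun x : ℝ => x ^ k) ν := by
  refine (h.const_mul (k.factorial : ℝ)).mono' (by fun_prop)
    (Filter.Eventually.of_forall fun x => ?_)
  have := Real.pow_div_factorial_le_exp |x| (abs_nonneg x) k
  rw [div_le_iff₀ (by positivity)] at this
  rw [norm_pow, Real.norm_eq_abs, one_mul]
  linarith

/-- A measure with all exponential moments is determinate. -/
theorem isDeterminate_of_integrable_exp_abs {μ : Measure ℝ} [IsFiniteMeasure μ]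
    (h : ∀ t, Integrable (fun x : ℝ => Real.exp |t * x|) μ) : IsDeterminate μ := by
  have hμ := integrable_pow_of_integrable_exp_abs (h 1)
  refine ⟨hμ, fun ν hν hm => ?_⟩
  -- Exponential moments transfer to `ν` because the `cosh` integrals are functions of the moments.
  have h' (t : ℝ) : Integrable (fun x : ℝ => Real.exp |t * x|) ν := by
    rw [integrable_exp_abs_iff, lintegral_cosh_eq_tsum fun k => (hm k).1]
    simp_rw [fun k => (hm k).2]
    rw [← lintegral_cosh_eq_tsum hμ, ← integrable_exp_abs_iff]
    exact h t
  refine Measure.ext_of_charFun (funext fun t => ?_)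
  rw [charFun_eq_tsum h', charFun_eq_tsum h]
  simp_rw [fun k => (hm k).2]

end Determinacy

/-! ## Projection-valued measures -/

section Projection

open MeasureTheory

variable {G : Type*} [NormedAddCommGroup G] [InnerProductSpace ℂ G] [CompleteSpace G]

namespace SemispectralMeasure

omit [CompleteSpace G] in
@[ext]
theorem ext_of_measurableSet {E F : SemispectralMeasure G}
    (h : ∀ B, MeasurableSet B → E B = F B) : E = F := by
  have : E.toFun = F.toFun := by
    funext B
    by_cases hB : MeasurableSet B
    · exact h B hB
    · rw [E.not_measurable' B hB, F.not_measurable' B hB]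
  cases E; cases F; congr

variable (F : SemispectralMeasure G)

instance (φ : G) : IsFiniteMeasure (F.measure φ) :=
  ⟨by rw [F.measure_apply φ MeasurableSet.univ]; exact ENNReal.ofReal_lt_top⟩

theorem measureReal_apply (φ : G) {B : Set ℝ} (hB : MeasurableSet B) :
    (F.measure φ).real B = (⟪φ, F B φ⟫_ℂ).re := by
  rw [Measure.real, F.measure_apply φ hB,
    ENNReal.toReal_ofReal (by exact (F.pos' B hB).re_inner_nonneg_right φ)]

theorem inner_apply_self (φ : G) {B : Set ℝ} (hB : MeasurableSet B) :
    ⟪φ, F B φ⟫_ℂ = ((F.measure φ).real B : ℂ) := by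
  rw [measureReal_apply F φ hB]
  have h := (F.pos' B hB).isSelfAdjoint.isSymmetric φ φ
  apply Complex.ext
  · simp
  · have h2 := inner_conj_symm (𝕜 := ℂ) φ (F B φ)
    rw [show ⟪F B φ, φ⟫_ℂ = ⟪φ, F B φ⟫_ℂ from h] at h2
    simpa using Complex.conj_eq_iff_im.1 h2

theorem apply_union {B C : Set ℝ} (hB : MeasurableSet B) (hC : MeasurableSet C)
    (h : Disjoint B C) : F (B ∪ C) = F B + F C := by
  apply ContinuousLinearMap.coe_injective
  rw [← ext_inner_map]
  intro φ
  rw [← inner_conj_symm, ← inner_conj_symm (((F B + F C : G →L[ℂ] G) : G →ₗ[ℂ] G) φ)]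
  congr 1
  simp only [ContinuousLinearMap.coe_coe, _root_.add_apply, inner_add_right]
  rw [F.inner_apply_self φ (hB.union hC), F.inner_apply_self φ hB, F.inner_apply_self φ hC,
    measureReal_union h hC]
  push_cast; rfl

theorem apply_compl {B : Set ℝ} (hB : MeasurableSet B) : F Bᶜ = 1 - F B := by
  rw [eq_sub_iff_add_eq', ← F.apply_union hB hB.compl disjoint_compl_right,
    Set.union_compl_self, F.univ']

variable {F} (hF : ∀ B, MeasurableSet B → IsStarProjection (F B))
include hF

theorem inner_apply_left {B : Set ℝ} (hB : MeasurableSet B) (φ ψ : G) :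
    ⟪F B φ, ψ⟫_ℂ = ⟪φ, F B ψ⟫_ℂ :=
  (hF B hB).isSelfAdjoint.isSymmetric φ ψ

theorem apply_apply_self {B : Set ℝ} (hB : MeasurableSet B) (φ : G) : F B (F B φ) = F B φ :=
  congrArg (fun T : G →L[ℂ] G => T φ) (hF B hB).isIdempotentElem

theorem norm_apply_sq {B : Set ℝ} (hB : MeasurableSet B) (φ : G) :
    ‖F B φ‖ ^ 2 = (F.measure φ).real B := by
  have h : ⟪F B φ, F B φ⟫_ℂ = ((F.measure φ).real B : ℂ) := by
    rw [inner_apply_left hF hB, apply_apply_self hF hB, inner_apply_self F φ hB]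
  rw [inner_self_eq_norm_sq_to_K] at h
  apply Complex.ofReal_injective
  rw [← h]; push_cast; rfl

theorem apply_apply_of_disjoint {B C : Set ℝ} (hB : MeasurableSet B) (hC : MeasurableSet C)
    (h : Disjoint B C) (φ : G) : F C (F B φ) = 0 := by
  have h0 : F Bᶜ (F B φ) = 0 := by
    rw [F.apply_compl hB]; simp [apply_apply_self hF hB]
  have h1 : (F.measure (F B φ)).real Bᶜ = 0 := by
    rw [← norm_apply_sq hF hB.compl, h0]; simp
  have h2 : (F.measure (F B φ)).real C ≤ 0 :=
    h1 ▸ measureReal_mono h.subset_compl_left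
  rw [← norm_apply_sq hF hC] at h2
  simpa using le_antisymm h2 (sq_nonneg _)

/-- Multiplicativity follows from additivity and idempotence: cut `C` along `B` and `φ` along `F B`;
the cross terms live on disjoint sets. -/
theorem apply_apply {B C : Set ℝ} (hB : MeasurableSet B) (hC : MeasurableSet C) (φ : G) :
    F C (F B φ) = F (C ∩ B) φ := by
  have h1 : F C (F B φ) = F (C ∩ B) (F B φ) := by
    conv_lhs => rw [← Set.inter_union_sdiff C B]
    rw [F.apply_union (hC.inter hB) (hC.diff hB)
      (Set.disjoint_sdiff_right.mono_left Set.inter_subset_right)]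
    simp [apply_apply_of_disjoint hF hB (hC.diff hB) Set.disjoint_sdiff_right]
  have h2 := apply_apply_of_disjoint hF hB.compl (hC.inter hB)
    (disjoint_compl_left.mono_right Set.inter_subset_right) φ
  rw [F.apply_compl hB] at h2
  simp only [_root_.sub_apply, one_apply_eq_self, map_sub, sub_eq_zero] at h2
  rw [h1, h2]

theorem inner_apply_apply {B C : Set ℝ} (hB : MeasurableSet B) (hC : MeasurableSet C) (φ : G) :
    ⟪φ, F C (F B φ)⟫_ℂ = ((F.measure φ).real (C ∩ B) : ℂ) := by
  rw [apply_apply hF hB hC, F.inner_apply_self φ (hC.inter hB)]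

theorem inner_apply_apply_apply {B C : Set ℝ} (hB : MeasurableSet B) (hC : MeasurableSet C)
    (φ : G) : ⟪F B φ, F C (F B φ)⟫_ℂ = ((F.measure φ).real (C ∩ B) : ℂ) := by
  rw [apply_apply hF hB hC, inner_apply_left hF hB, apply_apply hF (hC.inter hB) hB,
    F.inner_apply_self φ (hB.inter (hC.inter hB)), Set.inter_eq_right.2 Set.inter_subset_right]

/-- On `B` the density is multiplied by `|1 + c|²`. The cases `c = 1` and `c = I` serve for
polarization. -/
theorem measure_add_smul_apply {B : Set ℝ} (hB : MeasurableSet B) (φ : G) (c : ℂ)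
    (hc : 0 ≤ 2 * c.re + ‖c‖ ^ 2) :
    F.measure (φ + c • F B φ) =
      F.measure φ + ENNReal.ofReal (2 * c.re + ‖c‖ ^ 2) • (F.measure φ).restrict B := by
  ext C hC
  have h1 : ⟪φ, F C (F B φ)⟫_ℂ = ((F.measure φ).real (C ∩ B) : ℂ) := inner_apply_apply hF hB hC φ
  have h2 : ⟪F B φ, F C φ⟫_ℂ = ((F.measure φ).real (C ∩ B) : ℂ) := by
    rw [inner_apply_left hF hB, inner_apply_apply hF hC hB, Set.inter_comm]
  have h3 := inner_apply_apply_apply hF hB hC φ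
  have h4 : (⟪φ + c • F B φ, F C (φ + c • F B φ)⟫_ℂ).re =
      (F.measure φ).real C + (2 * c.re + ‖c‖ ^ 2) * (F.measure φ).real (C ∩ B) := by
    simp only [map_add, map_smul, inner_add_left, inner_add_right, inner_smul_left,
      inner_smul_right, h1, h2, h3, F.inner_apply_self φ hC]
    rw [← Complex.normSq_eq_norm_sq, Complex.normSq_apply]
    simp
    ring
  rw [F.measure_apply _ hC, h4, Measure.add_apply, Measure.smul_apply, Measure.restrict_apply hC,
    ENNReal.ofReal_add measureReal_nonneg (mul_nonneg hc measureReal_nonneg),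
    ENNReal.ofReal_mul hc, ofReal_measureReal, ofReal_measureReal, smul_eq_mul]

theorem measure_apply_eq_restrict {B : Set ℝ} (hB : MeasurableSet B) (φ : G) :
    F.measure (F B φ) = (F.measure φ).restrict B := by
  ext C hC
  have h3 := inner_apply_apply_apply hF hB hC φ
  rw [F.measure_apply _ hC, h3, Measure.restrict_apply hC, Complex.ofReal_re, ofReal_measureReal]

omit hF in
/-- A spectral measure acts on the eigenvectors of its operator by the indicator function of
the eigenvalue. -/
theorem IsSpectralMeasureOf.apply_eigenvector {S : G →ₗ.[ℂ] G} (hFS : F.IsSpectralMeasureOf S)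
    (w : S.domain) (r : ℝ) (hw : S w = (r : ℂ) • (w : G)) {B : Set ℝ} (hB : MeasurableSet B)
    [Decidable (r ∈ B)] : F B (w : G) = if r ∈ B then (w : G) else 0 := by
  obtain ⟨hF, hdom, hval⟩ := hFS
  have h2 : Integrable (fun x : ℝ => x ^ 2) (F.measure w) := (hdom w).1 w.2
  have h1 : Integrable (fun x : ℝ => x) (F.measure w) := by
    refine (h2.add (integrable_const 1)).mono' (by fun_prop)
      (Filter.Eventually.of_forall fun x => ?_)
    rw [Real.norm_eq_abs, Pi.add_apply, ← sq_abs x]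
    nlinarith [abs_nonneg x]
  have key (C : Set ℝ) (hC : MeasurableSet C) :
      r * (F.measure w).real C = ∫ x in C, x ∂F.measure w := by
    have hv : F C w ∈ S.domain := by
      rw [hdom, measure_apply_eq_restrict hF hC]
      exact h2.restrict
    let v : S.domain := ⟨F C w, hv⟩
    have q0 := hval w
    have qv := hval v
    rw [show ((v : S.domain) : G) = F C w from rfl, measure_apply_eq_restrict hF hC] at qv
    -- Only the quadratic form of `S` is known, and `S` is not assumed symmetric. Taking `c = 1`
    -- gives the sum of the two cross terms, and `c = I` shows that they are equal; hence each is
    -- the integral of `x` over `C`.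
    have q1 := hval (w + (1 : ℂ) • v)
    have q2 := hval (w + Complex.I • v)
    have m1 := measure_add_smul_apply hF hC (w : G) 1 (by norm_num)
    have m2 := measure_add_smul_apply hF hC (w : G) Complex.I (by norm_num)
    rw [show ((w + (1 : ℂ) • v : S.domain) : G) = w + (1 : ℂ) • F C w from rfl, m1,
      integral_add_measure h1 (h1.restrict.smul_measure ENNReal.ofReal_ne_top),
      integral_smul_measure, ENNReal.toReal_ofReal (by norm_num)] at q1
    rw [show ((w + Complex.I • v : S.domain) : G) = w + Complex.I • F C w from rfl, m2,
      integral_add_measure h1 (h1.restrict.smul_measure ENNReal.ofReal_ne_top),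
      integral_smul_measure, ENNReal.toReal_ofReal (by norm_num)] at q2
    simp only [LinearPMap.map_add, LinearPMap.map_smul, inner_add_left, inner_add_right,
      inner_smul_left, inner_smul_right, q0, qv] at q1 q2
    have hwv : ⟪F C w, S w⟫_ℂ = ((r * (F.measure w).real C : ℝ) : ℂ) := by
      rw [hw, inner_smul_right, inner_apply_left hF hC, F.inner_apply_self _ hC]
      push_cast; rfl
    rw [hwv] at q1 q2
    apply Complex.ofReal_injective
    norm_num at q1 q2
    push_cast
    linear_combination (1 / 2) * q1 + (Complex.I / 2) * q2 +
      ((r : ℂ) * ((F.measure w).real C) / 2 - ⟪(w : G), S v⟫_ℂ / 2 +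
        ((∫ x in C, x ∂F.measure w : ℝ) : ℂ) * Complex.I / 2) * Complex.I_sq
  have hae : ∀ᵐ x ∂F.measure w, x = r := by
    have hi : Integrable (fun x : ℝ => x - r) (F.measure w) := h1.sub (integrable_const r)
    filter_upwards [hi.ae_eq_zero_of_forall_setIntegral_eq_zero fun C hC _ => by
      rw [integral_sub h1.restrict (integrable_const r).restrict, ← key C hC]
      simp [mul_comm]] with x hx
    exact sub_eq_zero.1 hx
  have hz (C : Set ℝ) (hC : MeasurableSet C) (hr : r ∉ C) : F C w = 0 := by
    have : (F.measure w).real C = 0 := by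
      have h0 : F.measure w C = 0 := by
        refine measure_mono_null (fun x hx => ?_) hae
        rintro (rfl : x = r)
        exact hr hx
      simp [Measure.real, h0]
    rw [← norm_apply_sq hF hC] at this
    simpa using this
  split_ifs with hr
  · have := hz Bᶜ hB.compl (by simpa using hr)
    rw [F.apply_compl hB] at this
    exact (sub_eq_zero.1 (by simpa using this)).symm
  · exact hz B hB hr

end SemispectralMeasure

end Projection

/-! ## Diagonal operators -/

section Diagonal

open MeasureTheory

variable {G : Type*} [NormedAddCommGroup G] [InnerProductSpace ℂ G]
  {ι : Type*} (u : HilbertBasis ι ℂ G) (l : ι → ℝ)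

theorem summable_norm_inner_sq (φ : G) : Summable fun i => ‖⟪u i, φ⟫_ℂ‖ ^ 2 := by
  simpa using u.orthonormal.inner_products_summable φ

theorem hasSum_indicator_of_pairwise_disjoint {α E : Type*} [AddCommMonoid E] [TopologicalSpace E]
    {s : ℕ → Set α} (hs : Pairwise (Function.onFun Disjoint s)) (g : α → E) (x : α) :
    HasSum (fun n => (s n).indicator g x) ((⋃ n, s n).indicator g x) := by
  by_cases hx : x ∈ ⋃ n, s n
  · obtain ⟨n, hn⟩ := Set.mem_iUnion.1 hx
    rw [Set.indicator_of_mem hx, ← Set.indicator_of_mem hn g]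
    exact hasSum_single n fun m hm =>
      Set.indicator_of_notMem (fun h => Set.disjoint_left.1 (hs hm) h hn) g
  · rw [Set.indicator_of_notMem hx]
    have : (fun n => (s n).indicator g x) = fun _ => 0 := funext fun n =>
      Set.indicator_of_notMem (fun h => hx (Set.mem_iUnion.2 ⟨n, h⟩)) g
    rw [this]
    exact hasSum_zero

/-- `S` is the maximal operator with eigenvectors `u i` and eigenvalues `l i`. -/
def IsDiagonal (S : G →ₗ.[ℂ] G) : Prop :=
  (∀ φ, φ ∈ S.domain ↔ Summable fun i => l i ^ 2 * ‖⟪u i, φ⟫_ℂ‖ ^ 2) ∧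
    ∀ (φ : S.domain) (i : ι), ⟪u i, S φ⟫_ℂ = (l i : ℂ) * ⟪u i, (φ : G)⟫_ℂ

variable {u l}

/-- For `c = 0` the domain would stay that of `S`, which need not be the maximal domain of the zero
operator. -/
theorem IsDiagonal.smul {S : G →ₗ.[ℂ] G} (h : IsDiagonal u l S) {c : ℝ} (hc : c ≠ 0) :
    IsDiagonal u (fun i => c * l i) ((c : ℂ) • S) := by
  refine ⟨fun φ => ?_, fun φ i => ?_⟩
  · rw [show φ ∈ ((c : ℂ) • S).domain ↔ φ ∈ S.domain from Iff.rfl, h.1 φ,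
      ← summable_mul_left_iff (pow_ne_zero 2 hc)]
    simp_rw [mul_pow, mul_assoc]
  · rw [LinearPMap.smul_apply, inner_smul_right, h.2 φ i]
    push_cast
    ring

theorem eq_of_inner_basis {x y : G} (h : ∀ i, ⟪u i, x⟫_ℂ = ⟪u i, y⟫_ℂ) : x = y := by
  apply u.repr.injective
  ext i
  simpa [u.repr_apply_apply] using h i

theorem IsDiagonal.exists_eigenvector {S : G →ₗ.[ℂ] G} (h : IsDiagonal u l S) (i : ι) :
    ∃ w : S.domain, (w : G) = u i ∧ S w = (l i : ℂ) • (w : G) := by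
  classical
  have hin (j : ι) : ⟪u j, u i⟫_ℂ = if j = i then 1 else 0 :=
    orthonormal_iff_ite.1 u.orthonormal j i
  have hm : u i ∈ S.domain := by
    rw [h.1]
    refine summable_of_ne_finset_zero (s := {i}) fun j hj => ?_
    rw [hin, if_neg (by simpa using hj)]
    simp
  refine ⟨⟨u i, hm⟩, rfl, eq_of_inner_basis (u := u) fun j => ?_⟩
  rw [h.2, inner_smul_right]
  simp only [hin]
  split_ifs with hji
  · rw [hji]
  · simp

variable [CompleteSpace G]

theorem IsDiagonal.spectralMeasure_unique {S : G →ₗ.[ℂ] G} (h : IsDiagonal u l S)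
    {E F : SemispectralMeasure G} (hE : E.IsSpectralMeasureOf S) (hF : F.IsSpectralMeasureOf S) :
    E = F := by
  classical
  ext1 B hB
  refine ContinuousLinearMap.ext_on (Submodule.dense_iff_topologicalClosure_eq_top.2 u.dense_span) ?_
  rintro _ ⟨i, rfl⟩
  obtain ⟨w, hw, hSw⟩ := h.exists_eigenvector i
  rw [← hw, hE.apply_eigenvector w (l i) hSw hB, hF.apply_eigenvector w (l i) hSw hB]

variable (u l)

/-- The orthogonal projection onto the closed span of the basis vectors with label in `B`. -/
def diagonalProjection (B : Set ℝ) : G →L[ℂ] G :=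
  (Submodule.span ℂ (u '' {i | l i ∈ B})).topologicalClosure.starProjection

theorem isStarProjection_diagonalProjection (B : Set ℝ) :
    IsStarProjection (diagonalProjection u l B) :=
  isStarProjection_starProjection

theorem diagonalProjection_basis (B : Set ℝ) (i : ι) [Decidable (l i ∈ B)] :
    diagonalProjection u l B (u i) = if l i ∈ B then u i else 0 := by
  split_ifs with h
  · exact Submodule.starProjection_eq_self_iff.2
      (Submodule.le_topologicalClosure _ (Submodule.subset_span ⟨i, h, rfl⟩))
  · refine (Submodule.starProjection_apply_eq_zero_iff _).2 ?_
    rw [Submodule.orthogonal_closure, Submodule.mem_orthogonal]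
    intro w hw
    induction hw using Submodule.span_induction with
    | mem x hx =>
      obtain ⟨j, hj, rfl⟩ := hx
      exact u.orthonormal.2 fun hji => h (hji ▸ hj)
    | zero => simp
    | add x y _ _ hx hy => rw [inner_add_left, hx, hy, add_zero]
    | smul c x _ hx => rw [inner_smul_left, hx, mul_zero]

theorem inner_diagonalProjection (B : Set ℝ) (i : ι) (φ : G) :
    ⟪u i, diagonalProjection u l B φ⟫_ℂ = B.indicator (fun _ => ⟪u i, φ⟫_ℂ) (l i) := by
  classical
  rw [show ⟪u i, diagonalProjection u l B φ⟫_ℂ = ⟪diagonalProjection u l B (u i), φ⟫_ℂ from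
    ((isStarProjection_diagonalProjection u l B).isSelfAdjoint.isSymmetric (u i) φ).symm,
    diagonalProjection_basis, Set.indicator_apply]
  split_ifs <;> simp

theorem hasSum_inner_diagonalProjection (B : Set ℝ) (φ ψ : G) :
    HasSum (fun i => B.indicator (fun _ => ⟪ψ, u i⟫_ℂ * ⟪u i, φ⟫_ℂ) (l i))
      ⟪ψ, diagonalProjection u l B φ⟫_ℂ := by
  have h : (fun i => B.indicator (fun _ => ⟪ψ, u i⟫_ℂ * ⟪u i, φ⟫_ℂ) (l i)) =
      fun i => ⟪ψ, u i⟫_ℂ * ⟪u i, diagonalProjection u l B φ⟫_ℂ := by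
    funext i
    rw [inner_diagonalProjection]
    by_cases h : l i ∈ B <;> simp [h]
  rw [h]
  exact u.hasSum_inner_mul_inner ψ (diagonalProjection u l B φ)

open Classical in
/-- The spectral measure of the operator with eigenvectors `u i` and eigenvalues `l i`. -/
def diagonalMeasure : SemispectralMeasure G where
  toFun B := if MeasurableSet B then diagonalProjection u l B else 0
  pos' B hB := by
    rw [if_pos hB]
    exact ContinuousLinearMap.IsPositive.of_isStarProjection
      (isStarProjection_diagonalProjection u l B)
  univ' := by
    rw [if_pos MeasurableSet.univ]
    refine ContinuousLinearMap.ext_on (Submodule.dense_iff_topologicalClosure_eq_top.2 u.dense_span) ?_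
    rintro _ ⟨i, rfl⟩
    simp [diagonalProjection_basis]
  not_measurable' B hB := if_neg hB
  iUnion' := by
    intro f hf hd φ ψ
    simp only [hf, MeasurableSet.iUnion hf, if_true]
    have hs : Summable fun i => ‖⟪ψ, u i⟫_ℂ * ⟪u i, φ⟫_ℂ‖ :=
      (u.summable_inner_mul_inner ψ φ).norm
    have hfin (s : Finset ℕ) : ∑ n ∈ s, ⟪ψ, diagonalProjection u l (f n) φ⟫_ℂ =
        ∑' i, ∑ n ∈ s, (f n).indicator (fun _ => ⟪ψ, u i⟫_ℂ * ⟪u i, φ⟫_ℂ) (l i) :=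
      (hasSum_sum fun n _ => hasSum_inner_diagonalProjection u l (f n) φ ψ).tsum_eq.symm
    rw [HasSum, ← (hasSum_inner_diagonalProjection u l (⋃ n, f n) φ ψ).tsum_eq]
    simp_rw [hfin]
    -- Weak σ-additivity is an exchange of two sums: by disjointness each finite sum of indicators
    -- is again an indicator, so the coefficient products dominate.
    refine tendsto_tsum_of_dominated_convergence hs (fun i => ?_)
      (Filter.Eventually.of_forall fun s i => ?_)
    · exact hasSum_indicator_of_pairwise_disjoint hd _ _
    · rw [← Finset.indicator_biUnion_apply]
      · exact norm_indicator_le_norm_self _ _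
      · exact fun a _ b _ hab => hd hab

theorem diagonalMeasure_apply {B : Set ℝ} (hB : MeasurableSet B) :
    diagonalMeasure u l B = diagonalProjection u l B :=
  if_pos hB

theorem measure_diagonalMeasure (φ : G) :
    (diagonalMeasure u l).measure φ =
      Measure.sum fun i => ENNReal.ofReal (‖⟪u i, φ⟫_ℂ‖ ^ 2) • Measure.dirac (l i) := by
  ext B hB
  have h1 := Complex.reCLM.hasSum (hasSum_inner_diagonalProjection u l B φ φ)
  have h2 (i : ι) : (B.indicator (fun _ => ⟪φ, u i⟫_ℂ * ⟪u i, φ⟫_ℂ) (l i)).re =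
      B.indicator (fun _ => ‖⟪u i, φ⟫_ℂ‖ ^ 2) (l i) := by
    have : ⟪φ, u i⟫_ℂ * ⟪u i, φ⟫_ℂ = ((‖⟪u i, φ⟫_ℂ‖ ^ 2 : ℝ) : ℂ) := by
      rw [← inner_conj_symm φ (u i), ← Complex.normSq_eq_conj_mul_self,
        Complex.normSq_eq_norm_sq]
    by_cases h : l i ∈ B
    · simp only [h, Set.indicator_of_mem, this, Complex.ofReal_re]
    · simp [h]
  simp only [Complex.reCLM_apply, h2] at h1
  rw [SemispectralMeasure.measure_apply _ _ hB, diagonalMeasure_apply u l hB, ← h1.tsum_eq,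
    ENNReal.ofReal_tsum_of_nonneg
      (fun i => Set.indicator_nonneg (fun _ _ => sq_nonneg _) _) h1.summable,
    Measure.sum_apply _ hB]
  refine tsum_congr fun i => ?_
  rw [Measure.smul_apply, Measure.dirac_apply' _ hB]
  by_cases h : l i ∈ B <;> simp [h]

theorem integrable_diagonalMeasure_iff [Countable ι] (φ : G) (g : ℝ → ℝ) :
    Integrable g ((diagonalMeasure u l).measure φ) ↔
      Summable fun i => ‖⟪u i, φ⟫_ℂ‖ ^ 2 * ‖g (l i)‖ := by
  rw [measure_diagonalMeasure, integrable_sum_dirac_iff fun _ => ENNReal.ofReal_ne_top]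
  simp_rw [ENNReal.toReal_ofReal (sq_nonneg _)]

variable {u l} in
theorem IsDiagonal.isSpectralMeasureOf_diagonalMeasure [Countable ι] {S : G →ₗ.[ℂ] G}
    (h : IsDiagonal u l S) : (diagonalMeasure u l).IsSpectralMeasureOf S := by
  refine ⟨fun B hB => ?_, fun φ => ?_, fun φ => ?_⟩
  · rw [diagonalMeasure_apply u l hB]
    exact isStarProjection_diagonalProjection u l B
  · rw [h.1, integrable_diagonalMeasure_iff]
    refine summable_congr fun i => ?_
    rw [norm_pow, Real.norm_eq_abs, sq_abs, mul_comm]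
  · have hs : Summable fun i => ‖⟪u i, (φ : G)⟫_ℂ‖ ^ 2 * ‖l i‖ := by
      refine ((summable_norm_inner_sq u (φ : G)).add ((h.1 φ).1 φ.2)).of_nonneg_of_le
        (fun i => by positivity) fun i => ?_
      rw [← sq_abs (l i), Real.norm_eq_abs]
      nlinarith [abs_nonneg (l i), sq_nonneg (|l i| - 1), sq_nonneg ‖⟪u i, (φ : G)⟫_ℂ‖,
        mul_nonneg (sq_nonneg ‖⟪u i, (φ : G)⟫_ℂ‖) (sq_nonneg (|l i| - 1)),
        mul_nonneg (sq_nonneg ‖⟪u i, (φ : G)⟫_ℂ‖) (abs_nonneg (l i))]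
    have h1 := hasSum_integral_sum_dirac (f := fun x : ℝ => x)
      (c := fun i => ENNReal.ofReal (‖⟪u i, (φ : G)⟫_ℂ‖ ^ 2)) (x := l)
      (fun _ => ENNReal.ofReal_ne_top)
      (by simpa only [ENNReal.toReal_ofReal (sq_nonneg _)] using hs)
    rw [← measure_diagonalMeasure] at h1
    have h2 := u.hasSum_inner_mul_inner (φ : G) (S φ)
    refine HasSum.unique ?_ (Complex.ofRealCLM.hasSum h1)
    refine (congrArg (HasSum · _) (funext fun i => ?_)).mp h2
    rw [h.2, ENNReal.toReal_ofReal (sq_nonneg _), mul_left_comm, ← inner_conj_symm (φ : G) (u i),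
      ← Complex.normSq_eq_conj_mul_self, Complex.normSq_eq_norm_sq]
    simp [mul_comm]

variable {u l} in
/-- The closure of a symmetric operator with a complete system of eigenvectors is diagonal. -/
theorem isDiagonal_closure {T : G →ₗ.[ℂ] G} (hT : T.IsFormalAdjoint T)
    (hu : ∀ i, ∃ w : T.domain, (w : G) = u i ∧ T w = (l i : ℂ) • (w : G)) :
    IsDiagonal u l T.closure := by
  choose w hw hTw using hu
  have hspan : Submodule.span ℂ (Set.range u) ≤ T.domain := by
    rw [Submodule.span_le]
    rintro _ ⟨i, rfl⟩
    rw [← hw i]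
    exact (w i).2
  have hdense : Dense (T.domain : Set G) :=
    (Submodule.dense_iff_topologicalClosure_eq_top.2 u.dense_span).mono hspan
  -- A densely defined symmetric operator is contained in its adjoint, which is closed.
  have hcl : T.IsClosable :=
    (LinearPMap.adjoint_isClosed hdense).isClosable.leIsClosable (hT.le_adjoint hdense)
  have hgraph := hcl.graph_closure_eq_closure_graph
  -- Symmetry gives this relation on the graph of `T`, and it is a closed condition.
  have hcoeff (p : G × G) (hp : p ∈ T.closure.graph) (i : ι) :
      ⟪u i, p.2⟫_ℂ = (l i : ℂ) * ⟪u i, p.1⟫_ℂ := by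
    rw [← hgraph, ← SetLike.mem_coe, Submodule.topologicalClosure_coe] at hp
    refine closure_minimal (t := {p : G × G | ⟪u i, p.2⟫_ℂ = (l i : ℂ) * ⟪u i, p.1⟫_ℂ})
      (fun q hq => ?_) (isClosed_eq (by fun_prop) (by fun_prop)) hp
    obtain ⟨x, hx1, hx2⟩ := (LinearPMap.mem_graph_iff T).1 hq
    have := hT (w i) x
    rw [hTw, inner_smul_left, hw, hx1, hx2, Complex.conj_ofReal] at this
    exact this.symm
  refine ⟨fun φ => ⟨fun hφ => ?_, fun hφ => ?_⟩, fun φ i => ?_⟩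
  · refine (summable_norm_inner_sq u (T.closure ⟨φ, hφ⟩)).congr fun i => ?_
    rw [hcoeff _ (T.closure.mem_graph ⟨φ, hφ⟩) i, norm_mul, mul_pow, Complex.norm_real,
      Real.norm_eq_abs, sq_abs]
  · let c : lp (fun _ : ι => ℂ) 2 := ⟨fun i => (l i : ℂ) * ⟪u i, φ⟫_ℂ, by
      refine (memℓp_gen_iff (by norm_num)).2 ?_
      simpa [mul_pow] using hφ⟩
    -- Conversely, the finite partial sums lie in the graph of `T`, and both components converge.
    have h1 : HasSum (fun i => ⟪u i, φ⟫_ℂ • (u i, (l i : ℂ) • u i)) (φ, u.repr.symm c) := by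
      have ha := u.hasSum_repr φ
      have hb := u.hasSum_repr_symm c
      simp_rw [u.repr_apply_apply] at ha
      convert ha.prodMk hb using 2 with i
      ext1
      · rfl
      · change ⟪u i, φ⟫_ℂ • (l i : ℂ) • u i = ((l i : ℂ) * ⟪u i, φ⟫_ℂ) • u i
        rw [smul_smul, mul_comm]
    have h2 : (φ, u.repr.symm c) ∈ T.closure.graph := by
      rw [← hgraph, ← SetLike.mem_coe, Submodule.topologicalClosure_coe]
      refine mem_closure_of_tendsto h1 (Filter.Eventually.of_forall fun s => ?_)
      refine Submodule.sum_mem _ fun i _ => Submodule.smul_mem _ _ ?_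
      rw [← hw i, ← hTw]
      exact T.mem_graph (w i)
    exact LinearPMap.mem_domain_of_mem_graph h2
  · exact hcoeff _ (T.closure.mem_graph φ) i

end Diagonal

/-! ## Symmetric operators preserving a grading by finite-dimensional subspaces -/

section Graded

variable {G : Type*} [NormedAddCommGroup G] [InnerProductSpace ℂ G]

/-- The right side is independent of the basis, so layer weights can be computed in the product
basis without knowing the eigenvectors. -/
theorem sum_norm_inner_sq_eq {ι : Type*} [Fintype ι] {W : Submodule ℂ G} [FiniteDimensional ℂ W]
    (b : OrthonormalBasis ι ℂ W) (ψ : G) :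
    ∑ i, ‖⟪(b i : G), ψ⟫_ℂ‖ ^ 2 = ‖W.orthogonalProjectionOnto ψ‖ ^ 2 := by
  rw [← b.sum_sq_norm_inner_right]
  refine Finset.sum_congr rfl fun i _ => ?_
  rw [← Submodule.inner_orthogonalProjectionOnto_eq_of_mem_left]

/-- A symmetric operator that leaves invariant the finite-dimensional spaces spanned by the
classes of a partition of a Hilbert basis has a Hilbert basis of eigenvectors adapted to it. -/
theorem exists_graded_eigenbasis [CompleteSpace G] {J : Type*} {T : G →ₗ.[ℂ] G}
    (hT : T.IsFormalAdjoint T) (g : HilbertBasis J ℂ G) (s : ℕ → Finset J)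
    (hs : Pairwise (Function.onFun Disjoint s)) (hcover : ∀ j, ∃ n, j ∈ s n)
    (hmap : ∀ n, ∀ j ∈ s n, ∃ w : T.domain, (w : G) = g j ∧ T w ∈ Submodule.span ℂ (g '' s n)) :
    ∃ (d : ℕ → ℕ) (u : HilbertBasis (Σ n, Fin (d n)) ℂ G) (l : (Σ n, Fin (d n)) → ℝ),
      (∀ i, ∃ w : T.domain, (w : G) = u i ∧ T w = (l i : ℂ) • (w : G)) ∧
      (∀ i, u i ∈ Submodule.span ℂ (g '' s i.1)) ∧
      ∀ n ψ, ∑ i, ‖⟪u ⟨n, i⟩, ψ⟫_ℂ‖ ^ 2 = ∑ j ∈ s n, ‖⟪g j, ψ⟫_ℂ‖ ^ 2 := by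
  classical
  let W (n : ℕ) : Submodule ℂ G := Submodule.span ℂ ((s n).image g)
  have hW (n : ℕ) : W n = Submodule.span ℂ (g '' s n) := by simp only [W, Finset.coe_image]
  have hle (n : ℕ) : W n ≤ T.domain := by
    rw [hW, Submodule.span_le]
    rintro _ ⟨j, hj, rfl⟩
    obtain ⟨w, hw, -⟩ := hmap n j hj
    exact hw ▸ w.2
  have hinv (n : ℕ) (w : W n) : T (Submodule.inclusion (hle n) w) ∈ W n := by
    -- The vectors of the domain that `T` sends into `W n` form a subspace, so generators suffice.
    have : W n ≤ ((W n).comap T.toFun).map T.domain.subtype := by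
      conv_lhs => rw [hW]
      rw [Submodule.span_le]
      rintro _ ⟨j, hj, rfl⟩
      obtain ⟨w, hw, hTw⟩ := hmap n j hj
      exact ⟨w, by rwa [← hW] at hTw, hw⟩
    obtain ⟨x, hx, hxw⟩ := this w.2
    rwa [show Submodule.inclusion (hle n) w = x from Subtype.ext hxw.symm]
  let R (n : ℕ) : W n →ₗ[ℂ] W n :=
    LinearMap.codRestrict (W n) (T.toFun ∘ₗ Submodule.inclusion (hle n)) (hinv n)
  have hR (n : ℕ) : (R n).IsSymmetric := fun x y =>
    hT (Submodule.inclusion (hle n) x) (Submodule.inclusion (hle n) y)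
  let b (n : ℕ) := (hR n).eigenvectorBasis rfl
  have horth : OrthogonalFamily ℂ (fun n => W n) fun n => (W n).subtypeₗᵢ := by
    refine OrthogonalFamily.of_pairwise fun m n hmn => ?_
    change W m ⟂ W n
    rw [hW, hW, Submodule.isOrtho_span]
    rintro _ ⟨i, hi, rfl⟩ _ ⟨j, hj, rfl⟩
    exact g.orthonormal.2 fun hij => Finset.disjoint_left.1 (hs hmn) hi (hij ▸ hj)
  have hon := horth.orthonormal_sigma_orthonormal (fun n => (b n).orthonormal)
  have hmem (n : ℕ) (w : W n) : (w : G) ∈ Submodule.span ℂ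
      (Set.range fun i : Σ n, Fin (Module.finrank ℂ (W n)) => (W i.1).subtypeₗᵢ (b i.1 i.2)) := by
    rw [← (b n).sum_repr w, Submodule.coe_sum]
    exact Submodule.sum_mem _ fun i _ =>
      Submodule.smul_mem _ _ (Submodule.subset_span ⟨⟨n, i⟩, rfl⟩)
  let u := HilbertBasis.mk hon (by
    rw [← g.dense_span]
    refine Submodule.topologicalClosure_mono (Submodule.span_le.2 ?_)
    rintro _ ⟨j, rfl⟩
    obtain ⟨n, hn⟩ := hcover j
    exact hmem n ⟨g j, by rw [hW]; exact Submodule.subset_span ⟨j, hn, rfl⟩⟩)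
  have hu (i) : u i = (b i.1 i.2 : G) := by simp [u]
  refine ⟨fun n => Module.finrank ℂ (W n), u, fun i => (hR i.1).eigenvalues rfl i.2,
    fun i => ⟨Submodule.inclusion (hle i.1) (b i.1 i.2), (hu i).symm, ?_⟩, fun i => ?_,
    fun n ψ => ?_⟩
  · exact congrArg Subtype.val ((hR i.1).apply_eigenvectorBasis rfl i.2)
  · rw [hu, ← hW]
    exact (b i.1 i.2).2
  · simp_rw [hu]
    rw [sum_norm_inner_sq_eq (b n),
      ← sum_norm_inner_sq_eq (OrthonormalBasis.span g.orthonormal (s n)),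
      ← Finset.sum_coe_sort (s n) fun j => ‖⟪g j, ψ⟫_ℂ‖ ^ 2]
    refine Finset.sum_congr rfl fun j _ => ?_
    rw [OrthonormalBasis.span_apply]

end Graded

/-! ## The ladder operators -/

section Ladder

variable {H : Type*} [NormedAddCommGroup H] [InnerProductSpace ℂ H] (e : HilbertBasis ℕ ℂ H)

theorem inner_annihilation (φ : ladderDomain e) (n : ℕ) :
    ⟪e n, annihilation e φ⟫_ℂ = (Real.sqrt (n + 1) : ℂ) * ⟪e (n + 1), (φ : H)⟫_ℂ :=
  inner_ofCoeff e _ (summable_annihilation e φ) n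

theorem inner_creation (φ : ladderDomain e) (n : ℕ) :
    ⟪e n, creation e φ⟫_ℂ = (Real.sqrt n : ℂ) * ⟪e (n - 1), (φ : H)⟫_ℂ :=
  inner_ofCoeff e _ (summable_creation e φ) n

theorem annihilation_inner_eq (x y : ladderDomain e) :
    ⟪annihilation e x, (y : H)⟫_ℂ = ⟪(x : H), creation e y⟫_ℂ := by
  have h1 := e.hasSum_inner_mul_inner (annihilation e x) (y : H)
  -- The two series differ by an index shift; the zeroth term dropped here carries `√0`.
  have h2 := (hasSum_nat_add_iff' 1).2 (e.hasSum_inner_mul_inner (x : H) (creation e y))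
  simp only [Finset.range_one, Finset.sum_singleton, inner_creation, CharP.cast_eq_zero,
    Real.sqrt_zero, Complex.ofReal_zero, zero_mul, mul_zero, sub_zero] at h2
  refine h1.unique ((congrArg (HasSum · _) (funext fun n => ?_)).mp h2)
  rw [← inner_conj_symm (annihilation e x), inner_annihilation, map_mul, Complex.conj_ofReal,
    inner_conj_symm, Nat.add_sub_cancel, Nat.cast_add, Nat.cast_one]
  ring

theorem creation_inner_eq (x y : ladderDomain e) :
    ⟪creation e x, (y : H)⟫_ℂ = ⟪(x : H), annihilation e y⟫_ℂ := by
  rw [← inner_conj_symm, ← annihilation_inner_eq, inner_conj_symm]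

theorem basis_mem_ladderDomain (k : ℕ) : e k ∈ ladderDomain e := by
  change Summable fun n : ℕ => (n : ℝ) * ‖⟪e n, e k⟫_ℂ‖ ^ 2
  refine summable_of_ne_finset_zero (s := {k}) fun n hn => ?_
  rw [e.orthonormal.2 (by simpa using hn)]
  simp

/-- The basis vector `|k⟩` as an element of the domain of the ladder operators. -/
def ladderBasis (k : ℕ) : ladderDomain e := ⟨e k, basis_mem_ladderDomain e k⟩

theorem annihilation_basis (k : ℕ) :
    annihilation e (ladderBasis e k) = (Real.sqrt k : ℂ) • e (k - 1) := by
  refine eq_of_inner_basis (u := e) fun n => ?_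
  rw [inner_annihilation, inner_smul_right]
  change _ * ⟪e (n + 1), e k⟫_ℂ = _
  rw [orthonormal_iff_ite.1 e.orthonormal, orthonormal_iff_ite.1 e.orthonormal]
  rcases k with _ | k
  · simp
  · by_cases h : n = k
    · subst h; simp
    · simp [h]

theorem creation_basis (k : ℕ) :
    creation e (ladderBasis e k) = (Real.sqrt (k + 1) : ℂ) • e (k + 1) := by
  refine eq_of_inner_basis (u := e) fun n => ?_
  rw [inner_creation, inner_smul_right]
  change _ * ⟪e (n - 1), e k⟫_ℂ = _
  rw [orthonormal_iff_ite.1 e.orthonormal, orthonormal_iff_ite.1 e.orthonormal]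
  rcases n with _ | n
  · simp
  · by_cases h : n = k
    · subst h; simp
    · simp [h]

end Ladder

/-! ## The Hilbert space tensor product -/

section Tensor

variable {H K : Type*} [NormedAddCommGroup H] [InnerProductSpace ℂ H]
  [NormedAddCommGroup K] [InnerProductSpace ℂ K]

/-- The vector `x ⊗ y` of the Hilbert space tensor product. -/
def pureTensor (x : H) (y : K) : TwoMode H K := ((x ⊗ₜ[ℂ] y : H ⊗[ℂ] K) : TwoMode H K)

theorem inner_pureTensor (x x' : H) (y y' : K) :
    ⟪pureTensor x y, pureTensor x' y'⟫_ℂ = ⟪x, x'⟫_ℂ * ⟪y, y'⟫_ℂ := by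
  rw [pureTensor, pureTensor, UniformSpace.Completion.inner_coe, TensorProduct.inner_tmul]

theorem pureTensor_smul_smul (c d : ℂ) (x : H) (y : K) :
    pureTensor (c • x) (d • y) = (c * d) • pureTensor x y := by
  rw [pureTensor, TensorProduct.smul_tmul_smul, UniformSpace.Completion.coe_smul, pureTensor]

theorem appendCoherent_apply (f : HilbertBasis ℕ ℂ K) (z : ℂ) (φ : H) :
    appendCoherent H f z φ = pureTensor φ (coherent f z) := rfl

theorem apply_mem_of_basis_mem {E : Type*} [NormedAddCommGroup E] [NormedSpace ℂ E]
    (e : HilbertBasis ℕ ℂ H) (L : H →L[ℂ] E) {M : Submodule ℂ E} (hM : IsClosed (M : Set E))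
    (h : ∀ k, L (e k) ∈ M) (x : H) : L x ∈ M := by
  have h1 : (Submodule.span ℂ (Set.range e)).topologicalClosure ≤ M.comap (L : H →ₗ[ℂ] E) := by
    refine Submodule.topologicalClosure_minimal _ (Submodule.span_le.2 ?_)
      (hM.preimage L.continuous)
    rintro _ ⟨k, rfl⟩
    exact h k
  rw [e.dense_span] at h1
  exact h1 Submodule.mem_top

variable (e : HilbertBasis ℕ ℂ H) (f : HilbertBasis ℕ ℂ K)

theorem orthonormal_pureTensor :
    Orthonormal ℂ fun p : ℕ × ℕ => pureTensor (e p.1) (f p.2) := by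
  classical
  rw [orthonormal_iff_ite]
  intro p q
  rw [inner_pureTensor, orthonormal_iff_ite.1 e.orthonormal, orthonormal_iff_ite.1 f.orthonormal]
  simp only [Prod.ext_iff]
  split_ifs <;> simp_all

/-- A closed subspace containing the basis products contains all pure tensors, by continuity in one
factor at a time; linearity and completion do the rest. -/
theorem span_pureTensor_dense :
    ⊤ ≤ (Submodule.span ℂ (Set.range fun p : ℕ × ℕ =>
      pureTensor (e p.1) (f p.2))).topologicalClosure := by
  set M := (Submodule.span ℂ (Set.range fun p : ℕ × ℕ =>
      pureTensor (e p.1) (f p.2))).topologicalClosure with hM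
  have hMc : IsClosed (M : Set (TwoMode H K)) := Submodule.isClosed_topologicalClosure _
  let J : H ⊗[ℂ] K →L[ℂ] TwoMode H K := UniformSpace.Completion.toComplL
  have h1 (x : H) (y : K) : pureTensor x y ∈ M := by
    refine apply_mem_of_basis_mem e (J ∘L (TensorProduct.mkL ℂ H K).flip y) hMc (fun k => ?_) x
    refine apply_mem_of_basis_mem f (J ∘L TensorProduct.mkL ℂ H K (e k)) hMc (fun m => ?_) y
    exact Submodule.le_topologicalClosure _ (Submodule.subset_span ⟨(k, m), rfl⟩)
  have h2 (t : H ⊗[ℂ] K) : (t : TwoMode H K) ∈ M := by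
    induction t with
    | zero => exact M.zero_mem
    | tmul x y => exact h1 x y
    | add s t hs ht => rw [UniformSpace.Completion.coe_add]; exact M.add_mem hs ht
  rw [top_le_iff, Submodule.eq_top_iff']
  intro x
  induction x using UniformSpace.Completion.induction_on with
  | hp => exact hMc
  | ih t => exact h2 t

/-- The product basis `|k⟩ ⊗ |m⟩`. -/
def productBasis : HilbertBasis (ℕ × ℕ) ℂ (TwoMode H K) :=
  HilbertBasis.mk (orthonormal_pureTensor e f) (span_pureTensor_dense e f)

theorem productBasis_apply (p : ℕ × ℕ) :
    productBasis e f p = pureTensor (e p.1) (f p.2) := by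
  simp [productBasis]

/-! ## The coupling operator -/

theorem couplingCore_apply {w : (couplingCore e f).domain}
    {t : ladderDomain e ⊗[ℂ] ladderDomain f} (h : (w : TwoMode H K) = ladderInclusion e f t) :
    couplingCore e f w = ((1 / Real.sqrt 2 : ℝ) : ℂ) •
      (((TensorProduct.map (annihilation e) (creation f) t : H ⊗[ℂ] K) : TwoMode H K) +
        ((TensorProduct.map (creation e) (annihilation f) t : H ⊗[ℂ] K) : TwoMode H K)) := by
  have h1 : (LinearEquiv.ofInjective (ladderInclusion e f)
      (ladderInclusion_injective e f)).symm w = t :=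
    (LinearEquiv.symm_apply_eq _).2 (Subtype.ext h)
  rw [← UniformSpace.Completion.coe_add, ← LinearMap.add_apply, ← h1]
  rfl

theorem inner_map_eq {A₁ B₁ : ladderDomain e →ₗ[ℂ] H} {A₂ B₂ : ladderDomain f →ₗ[ℂ] K}
    (h₁ : ∀ x y : ladderDomain e, ⟪A₁ x, (y : H)⟫_ℂ = ⟪(x : H), B₁ y⟫_ℂ)
    (h₂ : ∀ x y : ladderDomain f, ⟪A₂ x, (y : K)⟫_ℂ = ⟪(x : K), B₂ y⟫_ℂ)
    (s t : ladderDomain e ⊗[ℂ] ladderDomain f) :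
    ⟪((TensorProduct.map A₁ A₂ s : H ⊗[ℂ] K) : TwoMode H K), ladderInclusion e f t⟫_ℂ =
      ⟪ladderInclusion e f s, ((TensorProduct.map B₁ B₂ t : H ⊗[ℂ] K) : TwoMode H K)⟫_ℂ := by
  induction s with
  | zero => simp [UniformSpace.Completion.coe_zero]
  | add s s' hs hs' =>
    simp only [map_add, UniformSpace.Completion.coe_add, inner_add_left, hs, hs']
  | tmul x y =>
    induction t with
    | zero => simp [UniformSpace.Completion.coe_zero]
    | add t t' ht ht' =>
      simp only [map_add, UniformSpace.Completion.coe_add, inner_add_right, ht, ht']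
    | tmul x' y' =>
      rw [TensorProduct.map_tmul, TensorProduct.map_tmul]
      change ⟪pureTensor (A₁ x) (A₂ y), pureTensor (x' : H) (y' : K)⟫_ℂ =
        ⟪pureTensor (x : H) (y : K), pureTensor (B₁ x') (B₂ y')⟫_ℂ
      rw [inner_pureTensor, inner_pureTensor, h₁, h₂]

theorem couplingCore_isFormalAdjoint : (couplingCore e f).IsFormalAdjoint (couplingCore e f) := by
  intro w w'
  obtain ⟨s, hs⟩ := w.2
  obtain ⟨t, ht⟩ := w'.2
  rw [couplingCore_apply e f hs.symm, couplingCore_apply e f ht.symm, ← hs, ← ht,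
    inner_smul_left, inner_smul_right, Complex.conj_ofReal, inner_add_left, inner_add_right]
  -- Taking adjoints exchanges the summands `a ⊗ b*` and `a* ⊗ b`.
  rw [inner_map_eq e f (annihilation_inner_eq e) (creation_inner_eq f),
    inner_map_eq e f (creation_inner_eq e) (annihilation_inner_eq f), add_comm]

theorem exists_couplingCore_productBasis (p : ℕ × ℕ) :
    ∃ w : (couplingCore e f).domain, (w : TwoMode H K) = productBasis e f p ∧
      couplingCore e f w = ((1 / Real.sqrt 2 : ℝ) : ℂ) •
        (((Real.sqrt p.1 : ℂ) * Real.sqrt (p.2 + 1)) • productBasis e f (p.1 - 1, p.2 + 1) +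
          ((Real.sqrt (p.1 + 1) : ℂ) * Real.sqrt p.2) • productBasis e f (p.1 + 1, p.2 - 1)) := by
  refine ⟨⟨ladderInclusion e f (ladderBasis e p.1 ⊗ₜ ladderBasis f p.2), ⟨_, rfl⟩⟩,
    (productBasis_apply e f p).symm, ?_⟩
  rw [couplingCore_apply e f (t := ladderBasis e p.1 ⊗ₜ ladderBasis f p.2) rfl,
    TensorProduct.map_tmul, TensorProduct.map_tmul,
    annihilation_basis, creation_basis, annihilation_basis, creation_basis, productBasis_apply, productBasis_apply,
    ← pureTensor_smul_smul, ← pureTensor_smul_smul]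
  rfl

theorem norm_inner_couplingCore_le {w : (couplingCore e f).domain} {p : ℕ × ℕ}
    (hw : (w : TwoMode H K) = productBasis e f p) {ψ : TwoMode H K} {m : ℝ}
    (hm : ∀ q, ‖⟪productBasis e f q, ψ⟫_ℂ‖ ≤ m) :
    ‖⟪couplingCore e f w, ψ⟫_ℂ‖ ≤ 2 * (p.1 + p.2 + 1) * m := by
  obtain ⟨w', hw', hT⟩ := exists_couplingCore_productBasis e f p
  obtain rfl : w = w' := Subtype.ext (hw.trans hw'.symm)
  have hm0 : 0 ≤ m := (norm_nonneg _).trans (hm 0)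
  have hsq (a b : ℕ) : ‖(Real.sqrt a : ℂ) * Real.sqrt (b + 1)‖ ≤ a + b + 1 := by
    rw [norm_mul, Complex.norm_real, Complex.norm_real, Real.norm_of_nonneg (Real.sqrt_nonneg _),
      Real.norm_of_nonneg (Real.sqrt_nonneg _), ← Real.sqrt_mul (Nat.cast_nonneg a)]
    refine Real.sqrt_le_iff.2 ⟨by positivity, ?_⟩
    have ha : (0 : ℝ) ≤ a := Nat.cast_nonneg a
    have hb : (0 : ℝ) ≤ b := Nat.cast_nonneg b
    nlinarith [mul_nonneg ha hb]
  have h3 : ‖(Real.sqrt (p.1 + 1) : ℂ) * Real.sqrt p.2‖ ≤ p.1 + p.2 + 1 := by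
    rw [mul_comm, add_comm (p.1 : ℝ) p.2]
    exact hsq p.2 p.1
  have h2 : ‖((1 / Real.sqrt 2 : ℝ) : ℂ)‖ ≤ 1 := by
    rw [Complex.norm_real, Real.norm_of_nonneg (by positivity), div_le_one (by positivity)]
    exact Real.one_le_sqrt.2 (by norm_num)
  rw [hT, inner_smul_left, inner_add_left, inner_smul_left, inner_smul_left, norm_mul,
    RCLike.norm_conj]
  calc _ ≤ 1 * ((p.1 + p.2 + 1) * m + (p.1 + p.2 + 1) * m) := by
        refine mul_le_mul h2 ((norm_add_le _ _).trans (add_le_add ?_ ?_)) (norm_nonneg _) zero_le_one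
        · rw [norm_mul, RCLike.norm_conj]
          exact mul_le_mul (hsq _ _) (hm _) (norm_nonneg _) (by positivity)
        · rw [norm_mul, RCLike.norm_conj]
          exact mul_le_mul h3 (hm _) (norm_nonneg _) (by positivity)
    _ = _ := by ring

/-- A Gershgorin argument: test the eigenvalue equation at the basis vector where `w` has its
largest coefficient. The matrix row has at most two entries, each at most `n + 1`. Only linear
growth in `n` matters. -/
theorem abs_eigenvalue_le {n : ℕ} {w : (couplingCore e f).domain} {r : ℝ}
    (hw : (w : TwoMode H K) ∈
      Submodule.span ℂ (productBasis e f '' (Finset.HasAntidiagonal.antidiagonal n : Set (ℕ × ℕ))))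
    (hw0 : (w : TwoMode H K) ≠ 0) (hr : couplingCore e f w = (r : ℂ) • (w : TwoMode H K)) :
    |r| ≤ 2 * (n + 1) := by
  have hout (q : ℕ × ℕ) (hq : q ∉ Finset.HasAntidiagonal.antidiagonal n) :
      ⟪productBasis e f q, (w : TwoMode H K)⟫_ℂ = 0 := by
    refine Submodule.span_induction ?_ (by simp) (fun x y _ _ hx hy => ?_) (fun c x _ hx => ?_) hw
    · rintro _ ⟨p, hp, rfl⟩
      exact (productBasis e f).orthonormal.2 fun h => hq (h ▸ hp)
    · rw [inner_add_right, hx, hy, add_zero]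
    · rw [inner_smul_right, hx, mul_zero]
  obtain ⟨p, hp, hmax⟩ := (Finset.HasAntidiagonal.antidiagonal n).exists_max_image
    (fun q => ‖⟪productBasis e f q, (w : TwoMode H K)⟫_ℂ‖)
    ⟨(0, n), Finset.HasAntidiagonal.mem_antidiagonal.2 (zero_add n)⟩
  have hall (q : ℕ × ℕ) : ‖⟪productBasis e f q, (w : TwoMode H K)⟫_ℂ‖ ≤
      ‖⟪productBasis e f p, (w : TwoMode H K)⟫_ℂ‖ := by
    by_cases hq : q ∈ Finset.HasAntidiagonal.antidiagonal n
    · exact hmax q hq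
    · rw [hout q hq, norm_zero]; exact norm_nonneg _
  have hpos : 0 < ‖⟪productBasis e f p, (w : TwoMode H K)⟫_ℂ‖ := by
    refine (norm_nonneg _).lt_of_ne' fun h0 => hw0 ?_
    refine eq_of_inner_basis (u := productBasis e f) fun q => ?_
    rw [inner_zero_right]
    exact norm_le_zero_iff.1 (h0 ▸ hall q)
  obtain ⟨v, hv, -⟩ := exists_couplingCore_productBasis e f p
  have h1 := norm_inner_couplingCore_le e f hv hall
  have h2 : ⟪couplingCore e f v, (w : TwoMode H K)⟫_ℂ =
      (r : ℂ) * ⟪productBasis e f p, (w : TwoMode H K)⟫_ℂ := by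
    rw [couplingCore_isFormalAdjoint e f v w, hr, inner_smul_right, hv]
  have hn : ((p.1 : ℝ) + p.2) = n := by exact_mod_cast Finset.HasAntidiagonal.mem_antidiagonal.1 hp
  rw [h2, norm_mul, Complex.norm_real, Real.norm_eq_abs, hn] at h1
  exact le_of_mul_le_mul_right h1 hpos

end Tensor

section EigenBasis

variable {H K : Type*} [NormedAddCommGroup H] [InnerProductSpace ℂ H]
  [NormedAddCommGroup K] [InnerProductSpace ℂ K]
  (e : HilbertBasis ℕ ℂ H) (f : HilbertBasis ℕ ℂ K)

/-- The coupling operator is diagonal in a basis adapted to the total number of quanta `n`,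
with eigenvalues of order `n`. -/
theorem exists_coupling_eigenbasis :
    ∃ (d : ℕ → ℕ) (u : HilbertBasis (Σ n, Fin (d n)) ℂ (TwoMode H K))
      (l : (Σ n, Fin (d n)) → ℝ), IsDiagonal u l (coupling e f) ∧
      (∀ i, |l i| ≤ 2 * (i.1 + 1)) ∧
      ∀ n ψ, ∑ i, ‖⟪u ⟨n, i⟩, ψ⟫_ℂ‖ ^ 2 =
        ∑ p ∈ Finset.HasAntidiagonal.antidiagonal n, ‖⟪productBasis e f p, ψ⟫_ℂ‖ ^ 2 := by
  obtain ⟨d, u, l, hu, hspan, hsum⟩ := exists_graded_eigenbasis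
    (couplingCore_isFormalAdjoint e f) (productBasis e f)
    (Finset.HasAntidiagonal.antidiagonal (A := ℕ))
    (fun m n hmn => Finset.disjoint_left.2 fun p hp hq => hmn <|
      (Finset.HasAntidiagonal.mem_antidiagonal.1 hp).symm.trans
        (Finset.HasAntidiagonal.mem_antidiagonal.1 hq))
    (fun p => ⟨p.1 + p.2, Finset.HasAntidiagonal.mem_antidiagonal.2 rfl⟩)
    (fun n p hp => by
      obtain ⟨w, hw, hT⟩ := exists_couplingCore_productBasis e f p
      have hp' : p.1 + p.2 = n := Finset.HasAntidiagonal.mem_antidiagonal.1 hp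
      have hmem (q : ℕ × ℕ) (hq : q.1 + q.2 = n) : productBasis e f q ∈ Submodule.span ℂ
          (productBasis e f '' (Finset.HasAntidiagonal.antidiagonal n : Set (ℕ × ℕ))) :=
        Submodule.subset_span ⟨q, Finset.HasAntidiagonal.mem_antidiagonal.2 hq, rfl⟩
      refine ⟨w, hw, hT ▸ Submodule.smul_mem _ _ (Submodule.add_mem _ ?_ ?_)⟩
      -- When `p.1 = 0`, truncated subtraction gives an index outside the layer, but its coefficient
      -- contains `√0`.
      · obtain h | h := Nat.eq_zero_or_pos p.1
        · simp [h]
        · exact Submodule.smul_mem _ _ (hmem (p.1 - 1, p.2 + 1) (by simp only; omega))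
      · obtain h | h := Nat.eq_zero_or_pos p.2
        · simp [h]
        · exact Submodule.smul_mem _ _ (hmem (p.1 + 1, p.2 - 1) (by simp only; omega)))
  refine ⟨d, u, l, isDiagonal_closure (couplingCore_isFormalAdjoint e f) hu, fun i => ?_, hsum⟩
  obtain ⟨w, hw, hTw⟩ := hu i
  exact abs_eigenvalue_le e f (hw ▸ hspan i) (hw ▸ u.orthonormal.ne_zero i) hTw

end EigenBasis

/-! ## Coherent states -/

section Coherent

variable {H : Type*} [NormedAddCommGroup H] [InnerProductSpace ℂ H] (e : HilbertBasis ℕ ℂ H)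

theorem norm_inner_coherent_sq (z : ℂ) (n : ℕ) :
    ‖⟪e n, coherent e z⟫_ℂ‖ ^ 2 =
      Real.exp (-‖z‖ ^ 2) * ((‖z‖ ^ 2) ^ n / n.factorial) := by
  rw [coherent, inner_ofCoeff, norm_mul, norm_div, norm_pow, Complex.norm_real, Complex.norm_real,
    mul_pow, div_pow, Real.norm_eq_abs, Real.norm_eq_abs, sq_abs, sq_abs,
    Real.sq_sqrt (by positivity), ← Real.exp_nat_mul, ← pow_mul, ← pow_mul, mul_comm n 2]
  congr 2
  push_cast
  ring

/-- Poisson weights have total mass one; this makes `V_z` an isometry. -/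
theorem norm_coherent (z : ℂ) : ‖coherent e z‖ = 1 := by
  have h1 := Complex.reCLM.hasSum (e.hasSum_inner_mul_inner (coherent e z) (coherent e z))
  have h2 := (NormedSpace.expSeries_div_hasSum_exp (‖z‖ ^ 2)).mul_left (Real.exp (-‖z‖ ^ 2))
  rw [← Real.exp_eq_exp_ℝ, ← Real.exp_add, neg_add_cancel, Real.exp_zero] at h2
  have h3 := h2.unique ((congrArg (HasSum · _) (funext fun n => ?_)).mp h1)
  · have h4 : ‖coherent e z‖ ^ 2 = 1 := by
      rw [h3, Complex.reCLM_apply, inner_self_eq_norm_sq_to_K]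
      norm_cast
    exact (pow_eq_one_iff_of_nonneg (norm_nonneg _) two_ne_zero).1 h4
  · rw [← norm_inner_coherent_sq e, Complex.reCLM_apply, ← inner_conj_symm _ (e n),
      ← Complex.normSq_eq_conj_mul_self, Complex.normSq_eq_norm_sq, Complex.ofReal_re]

theorem summable_pow_mul_norm_inner_coherent_sq (z : ℂ) (R : ℝ) :
    Summable fun n : ℕ => R ^ n * ‖⟪e n, coherent e z⟫_ℂ‖ ^ 2 := by
  refine ((Real.summable_pow_div_factorial (R * ‖z‖ ^ 2)).mul_left
    (Real.exp (-‖z‖ ^ 2))).congr fun n => ?_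
  rw [norm_inner_coherent_sq, mul_pow]
  ring

variable {K : Type*} [NormedAddCommGroup K] [InnerProductSpace ℂ K] (f : HilbertBasis ℕ ℂ K)

/-- Since `R ^ (k + m) = R ^ k * R ^ m`, this is the Cauchy product of two Poisson series, each
summable against any geometric factor. -/
theorem summable_pow_mul_sum_antidiagonal_coherent (β z : ℂ) (R : ℝ) :
    Summable fun n : ℕ => R ^ n * ∑ p ∈ Finset.HasAntidiagonal.antidiagonal n,
      ‖⟪productBasis e f p, pureTensor (coherent e β) (coherent f z)⟫_ℂ‖ ^ 2 := by
  have h := summable_norm_sum_mul_antidiagonal_of_summable_norm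
    (summable_pow_mul_norm_inner_coherent_sq e β R).norm
    (summable_pow_mul_norm_inner_coherent_sq f z R).norm
  refine h.of_norm.congr fun n => ?_
  rw [Finset.mul_sum]
  refine Finset.sum_congr rfl fun p hp => ?_
  rw [← Finset.HasAntidiagonal.mem_antidiagonal.1 hp, productBasis_apply, inner_pureTensor,
    norm_mul, pow_add]
  ring

end Coherent

/-! ## Vectors with exponential moments -/

section ExpMoments

variable {G : Type*} [NormedAddCommGroup G] [InnerProductSpace ℂ G] {ι : Type*}

/-- The vectors all of whose exponential moments with respect to a diagonal operator are finite. -/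
def expMomentSpace (u : HilbertBasis ι ℂ G) (l : ι → ℝ) : Submodule ℂ G where
  carrier := {ψ | ∀ t : ℝ, Summable fun i => ‖⟪u i, ψ⟫_ℂ‖ ^ 2 * Real.exp |t * l i|}
  zero_mem' t := by simp
  add_mem' := by
    intro x y hx hy t
    -- Cross terms are absorbed by `|a + b|² ≤ 2|a|² + 2|b|²`.
    refine (((hx t).add (hy t)).mul_left 2).of_nonneg_of_le (fun i => by positivity) fun i => ?_
    rw [← add_mul, ← mul_assoc]
    refine mul_le_mul_of_nonneg_right ?_ (Real.exp_pos _).le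
    rw [inner_add_right]
    have h := norm_add_le ⟪u i, x⟫_ℂ ⟪u i, y⟫_ℂ
    nlinarith [norm_nonneg (⟪u i, x⟫_ℂ + ⟪u i, y⟫_ℂ), sq_nonneg (‖⟪u i, x⟫_ℂ‖ - ‖⟪u i, y⟫_ℂ‖)]
  smul_mem' := by
    intro c x hx t
    refine ((hx t).mul_left (‖c‖ ^ 2)).congr fun i => ?_
    rw [inner_smul_right, norm_mul]
    ring

/-- In layer `n`, `exp |t l|` is at most `R ^ (n + 1)` with `R = exp (|t| C)`; since `t` is
arbitrary, all such `R` are needed. -/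
theorem mem_expMomentSpace_of_graded {d : ℕ → ℕ} {u : HilbertBasis (Σ n, Fin (d n)) ℂ G}
    {l : (Σ n, Fin (d n)) → ℝ} {C : ℝ} (hl : ∀ i, |l i| ≤ C * (i.1 + 1)) {ψ : G}
    (hψ : ∀ R : ℝ, Summable fun n : ℕ => R ^ n * ∑ i, ‖⟪u ⟨n, i⟩, ψ⟫_ℂ‖ ^ 2) :
    ψ ∈ expMomentSpace u l := by
  intro t
  rw [summable_sigma_of_nonneg fun i => by positivity]
  refine ⟨fun n => (hasSum_fintype _).summable, ?_⟩
  refine ((hψ (Real.exp (|t| * C))).mul_left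
    (Real.exp (|t| * C))).of_nonneg_of_le (fun n => tsum_nonneg fun i => by positivity)
    fun n => ?_
  rw [tsum_fintype, ← mul_assoc, ← pow_succ', Finset.mul_sum]
  refine Finset.sum_le_sum fun i _ => ?_
  rw [mul_comm]
  refine mul_le_mul_of_nonneg_right ?_ (sq_nonneg _)
  rw [← Real.exp_nat_mul, Real.exp_le_exp, abs_mul]
  push_cast
  calc |t| * |l ⟨n, i⟩| ≤ |t| * (C * (n + 1)) :=
        mul_le_mul_of_nonneg_left (hl ⟨n, i⟩) (abs_nonneg t)
    _ = _ := by ring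

theorem isDeterminate_diagonalMeasure [CompleteSpace G] [Countable ι] {u : HilbertBasis ι ℂ G}
    {l : ι → ℝ} {ψ : G} (hψ : ψ ∈ expMomentSpace u l) :
    IsDeterminate ((diagonalMeasure u l).measure ψ) := by
  refine isDeterminate_of_integrable_exp_abs fun t => ?_
  rw [integrable_diagonalMeasure_iff]
  simpa only [Real.norm_eq_abs, Real.abs_exp] using hψ t

end ExpMoments

/-! ## The homodyne observable -/

section Observable

variable {H G : Type*} [NormedAddCommGroup H] [InnerProductSpace ℂ H] [CompleteSpace H]
  [NormedAddCommGroup G] [InnerProductSpace ℂ G] [CompleteSpace G]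

/-- The compression `B ↦ V* F(B) V` of a semispectral measure by an isometry `V`. -/
def SemispectralMeasure.compress (F : SemispectralMeasure G) (V : H →L[ℂ] G)
    (hV : ContinuousLinearMap.adjoint V ∘L V = 1) : SemispectralMeasure H where
  toFun B := ContinuousLinearMap.adjoint V ∘L F B ∘L V
  pos' B hB := (F.pos' B hB).adjoint_conj V
  univ' := by rw [F.univ']; exact hV
  not_measurable' B hB := by rw [F.not_measurable' B hB]; simp
  iUnion' f hf hd φ ψ := by
    simpa [ContinuousLinearMap.adjoint_inner_right] using F.iUnion' f hf hd (V φ) (V ψ)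

theorem SemispectralMeasure.measure_eq_of_compress {F : SemispectralMeasure G}
    {E : SemispectralMeasure H} {V : H →L[ℂ] G}
    (h : ∀ B, MeasurableSet B → E B = ContinuousLinearMap.adjoint V ∘L F B ∘L V) (φ : H) :
    E.measure φ = F.measure (V φ) := by
  ext B hB
  rw [E.measure_apply φ hB, F.measure_apply _ hB, h B hB]
  simp [ContinuousLinearMap.adjoint_inner_right]

variable {K : Type*} [NormedAddCommGroup K] [InnerProductSpace ℂ K]

theorem adjoint_comp_appendCoherent (f : HilbertBasis ℕ ℂ K) (z : ℂ) :
    ContinuousLinearMap.adjoint (appendCoherent H f z) ∘L appendCoherent H f z = 1 := by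
  ext φ
  refine ext_inner_left ℂ fun ψ => ?_
  simp [ContinuousLinearMap.adjoint_inner_right, appendCoherent_apply, inner_pureTensor,
    inner_self_eq_norm_sq_to_K, norm_coherent]

end Observable

end Homodyne

end


theorem mainTheorem3
    {H K : Type*} [NormedAddCommGroup H] [InnerProductSpace ℂ H] [CompleteSpace H]
    [NormedAddCommGroup K] [InnerProductSpace ℂ K] [CompleteSpace K]
    (e : HilbertBasis ℕ ℂ H) (f : HilbertBasis ℕ ℂ K) (z : ℂ) (hz : z ≠ 0) :
    (∃! E : Homodyne.SemispectralMeasure H, Homodyne.IsHomodyneObservable e f z E) ∧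
      ∀ E : Homodyne.SemispectralMeasure H, Homodyne.IsHomodyneObservable e f z E →
        E.IsDeterminateOn (Homodyne.coherentSpan e : Set H) := by
  open Homodyne in
  obtain ⟨d, u, l, hdiag, hl, hsum⟩ := exists_coupling_eigenbasis e f
  have hS := hdiag.smul (inv_ne_zero (norm_ne_zero_iff.2 hz))
  have hF := hS.isSpectralMeasureOf_diagonalMeasure
  have hb (i : Σ n, Fin (d n)) : |‖z‖⁻¹ * l i| ≤ ‖z‖⁻¹ * 2 * ((i.1 : ℝ) + 1) := by
    rw [abs_mul, abs_of_nonneg (inv_nonneg.2 (norm_nonneg z)), mul_assoc]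
    exact mul_le_mul_of_nonneg_left (hl i) (inv_nonneg.2 (norm_nonneg z))
  refine ⟨⟨(diagonalMeasure u fun i => ‖z‖⁻¹ * l i).compress (appendCoherent H f z)
    (adjoint_comp_appendCoherent f z), ⟨_, hF, fun B _ => rfl⟩, ?_⟩, ?_⟩
  · rintro E ⟨F, hFS, hE⟩
    ext1 B hB
    rw [hE B hB, hS.spectralMeasure_unique hFS hF]
    rfl
  · rintro E ⟨F, hFS, hE⟩ φ hφ
    -- Whatever spectral measure witnesses `E`, it is the diagonal one, evaluated at `φ ⊗ |z⟩`.
    rw [SemispectralMeasure.measure_eq_of_compress hE, hS.spectralMeasure_unique hFS hF]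
    refine isDeterminate_diagonalMeasure ?_
    have hc (β : ℂ) : pureTensor (coherent e β) (coherent f z) ∈
        expMomentSpace u fun i => ‖z‖⁻¹ * l i := by
      refine mem_expMomentSpace_of_graded hb fun R => ?_
      simp_rw [hsum]
      exact summable_pow_mul_sum_antidiagonal_coherent e f β z R
    -- Exponential moments cut out a subspace and `V_z` is linear, so coherent states suffice.
    have hle : coherentSpan e ≤ (expMomentSpace u fun i => ‖z‖⁻¹ * l i).comap
        (appendCoherent H f z : H →ₗ[ℂ] TwoMode H K) := by
      refine Submodule.span_le.2 ?_
      rintro _ ⟨β, rfl⟩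
      exact hc β
    exact hle hφ
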